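/- Let $n\ge 0$ be an integer, let $Q^n=[0,1]^n\subset\mathbb R^n$ be the unit cube, and for $1\le i\le n$ let $F_i^+=\{x\in Q^n : x_i=1\}$ and $F_i^-=\{x\in Q^n : x_i=0\}$ be its opposite facets in the $i$-th direction. Suppose that $X_1,\dots,X_n\subseteq Q^n$ are closed sets with $Q^n=X_1\cup\dots\cup X_n$. Then there exist an index $i\in\{1,\dots,n\}$ and a connected component $C$ of $X_i$ such that $C\cap F_i^+\neq\emptyset$ and $C\cap F_i^-\neq\emptyset$. -/

import Mathlib

/-- The unit cube `[0, 1]^n` in `ℝ^n`. -/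
def unitCube (n : ℕ) : Set (Fin n → ℝ) :=
  {x | ∀ j, 0 ≤ x j ∧ x j ≤ 1}

/-- The facet `x_i = 1` of the unit cube. -/
def facetPlus {n : ℕ} (i : Fin n) : Set (Fin n → ℝ) :=
  {x | x ∈ unitCube n ∧ x i = 1}

/-- The facet `x_i = 0` of the unit cube. -/
def facetMinus {n : ℕ} (i : Fin n) : Set (Fin n → ℝ) :=
  {x | x ∈ unitCube n ∧ x i = 0}

/-- `C` is a connected component of the set `S` (with the subspace topology):
the component of some point of `S`. -/
def IsComponentOf {E : Type*} [TopologicalSpace E] (C S : Set E) : Prop :=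
  ∃ x ∈ S, C = connectedComponentIn S x

/-! If no component of `X i` joins the facets in direction `i`, compactness splits `X i` into
disjoint closed sets `A`, `B`, with `A` missing `x i = 0` and `B` missing `x i = 1`. Some continuous
`f i` is positive on `A` and on `x i = 1`, negative on `B` and on `x i = 0`. By Poincaré–Miranda the
`f i` have a common zero in the cube, which lies in no `X i`, against the covering. Poincaré–Miranda
is the limit of a grid statement, `exists_freudenthal_sign_change`. That follows from
`freudenthalSum_eq_one`: modulo two, the top cup product of the coboundaries of the sign labels
evaluates to 1 on the triangulated cube. -/

open Finset

/-! ### Cup products on the Freudenthal triangulation, modulo two -/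

/-- The `i`-th vertex of the Freudenthal simplex with base point `z`, where the direction `j`
is traversed at time `σ j`. -/
def freudenthalVertex {n : ℕ} (z : Fin n → ℕ) (σ : Equiv.Perm (Fin n)) (i : ℕ) : Fin n → ℕ :=
  fun j => z j + if (σ j : ℕ) < i then 1 else 0

/-- The sequence `y` with its `r`-th term left out. -/
def skipTerm {P : Type*} (y : ℕ → P) (r i : ℕ) : P :=
  if i < r then y i else y (i + 1)

/-- The value on `u 0, …, u m` of the cochain `c ⌣ δ (a 0) ⌣ ⋯ ⌣ δ (a (m - 1))` modulo two. -/
def cupCochain {P : Type*} (c : P → ZMod 2) (a : ℕ → P → ZMod 2) (m : ℕ) (u : ℕ → P) : ZMod 2 :=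
  c (u 0) * ∏ i ∈ range m, (a i (u (i + 1)) + a i (u i))

/-- The sum over all Freudenthal simplices in the grid `{0, …, k}^n` of the cup product of the
coboundaries of `a 0, …, a (n - 1)`. -/
def freudenthalSum {n : ℕ} (k : ℕ) (a : ℕ → (Fin n → ℕ) → ZMod 2) : ZMod 2 :=
  ∑ z ∈ Fintype.piFinset (fun _ : Fin n => range k), ∑ σ : Equiv.Perm (Fin n),
    ∏ i ∈ range n, (a i (freudenthalVertex z σ (i + 1)) + a i (freudenthalVertex z σ i))

theorem cupCochain_congr {P : Type*} (c : P → ZMod 2) (a : ℕ → P → ZMod 2) {m : ℕ}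
    {u v : ℕ → P} (h : ∀ i ≤ m, u i = v i) : cupCochain c a m u = cupCochain c a m v := by
  unfold cupCochain
  rw [h 0 (Nat.zero_le _)]
  congr 1
  refine prod_congr rfl fun i hi => ?_
  have := mem_range.1 hi
  rw [h i (by omega), h (i + 1) (by omega)]

theorem cupCochain_succ {P : Type*} (c : P → ZMod 2) (a : ℕ → P → ZMod 2) (m : ℕ)
    (u : ℕ → P) :
    cupCochain c a (m + 1) u = cupCochain c a m u * (a m (u (m + 1)) + a m (u m)) := by
  unfold cupCochain
  rw [prod_range_succ, mul_assoc]

/-- This is the Leibniz rule for `δ (c ⌣ δ a₀ ⌣ ⋯)`: as `δδ = 0`, only `δ c` contributes, and signs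
disappear modulo two. -/
theorem sum_cupCochain_skipTerm {P : Type*} (c : P → ZMod 2) (a : ℕ → P → ZMod 2) (m : ℕ)
    (y : ℕ → P) :
    ∑ r ∈ range (m + 2), cupCochain c a m (skipTerm y r) =
      (c (y 1) + c (y 0)) * ∏ i ∈ range m, (a i (y (i + 2)) + a i (y (i + 1))) := by
  induction m with
  | zero => simp [sum_range_succ, cupCochain, skipTerm]
  | succ m ih =>
    rw [sum_range_succ] at ih
    rw [sum_range_succ, sum_range_succ, prod_range_succ, ← mul_assoc, ← ih]
    have h1 : ∑ r ∈ range (m + 1), cupCochain c a (m + 1) (skipTerm y r) =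
        (∑ r ∈ range (m + 1), cupCochain c a m (skipTerm y r)) *
          (a m (y (m + 2)) + a m (y (m + 1))) := by
      rw [sum_mul]
      refine sum_congr rfl fun r hr => ?_
      have := mem_range.1 hr
      rw [cupCochain_succ]
      simp only [skipTerm]
      rw [if_neg (by omega), if_neg (by omega)]
    have h2 : cupCochain c a m (skipTerm y (m + 1 + 1)) =
        cupCochain c a m (skipTerm y (m + 1)) := by
      refine cupCochain_congr _ _ fun i hi => ?_
      simp only [skipTerm]
      rw [if_pos (by omega), if_pos (by omega)]
    rw [h1, cupCochain_succ, cupCochain_succ, h2]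
    have e1 : skipTerm y (m + 1) (m + 1) = y (m + 2) := by simp [skipTerm]
    have e2 : skipTerm y (m + 1) m = y m := by simp [skipTerm]
    have e3 : skipTerm y (m + 1 + 1) (m + 1) = y (m + 1) := by simp [skipTerm]
    have e4 : skipTerm y (m + 1 + 1) m = y m := by simp [skipTerm]
    rw [e1, e2, e3, e4]
    have := CharTwo.add_self_eq_zero (a m (y m))
    linear_combination cupCochain c a m (skipTerm y (m + 1)) * this

theorem sum_piFinset_range_shift {n k : ℕ} {M : Type*} [AddCommMonoid M] (s : Fin n)
    (f : (Fin n → ℕ) → M) (h0 : ∀ z, z s = 0 → f z = 0) (hk : ∀ z, z s = k → f z = 0) :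
    ∑ z ∈ Fintype.piFinset (fun _ : Fin n => range k), f (z + Pi.single s 1) =
      ∑ z ∈ Fintype.piFinset (fun _ : Fin n => range k), f z := by
  refine sum_bij_ne_zero (fun z _ _ => z + Pi.single s 1) ?_ ?_ ?_ ?_
  · intro z hz hne
    rw [Fintype.mem_piFinset] at hz ⊢
    intro j
    have hj := mem_range.1 (hz j)
    rcases eq_or_ne j s with rfl | hjs
    · have : (z + Pi.single j 1 : Fin n → ℕ) j ≠ k := fun h => hne (hk _ h)
      simp only [Pi.add_apply, Pi.single_eq_same, mem_range] at this ⊢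
      omega
    · simpa [hjs] using hj
  · intro z _ _ z' _ _ h
    exact add_right_cancel h
  · intro y hy hne
    have hys : y s ≠ 0 := fun h => hne (h0 _ h)
    have hyeq : (y - Pi.single s 1 : Fin n → ℕ) + Pi.single s 1 = y := by
      ext j
      rcases eq_or_ne j s with rfl | hjs
      · simp; omega
      · simp [hjs]
    refine ⟨y - Pi.single s 1, ?_, by rwa [hyeq], hyeq⟩
    rw [Fintype.mem_piFinset] at hy ⊢
    intro j
    have hj := mem_range.1 (hy j)
    simp only [Pi.sub_apply, mem_range]
    omega
  · intros; rfl

/-- An inner face lies in exactly two simplices of the same cell: exchanging the times `r` and `r +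
1` moves only the omitted vertex. -/
theorem sum_cupCochain_inner_eq_zero {m : ℕ} (c : (Fin (m + 1) → ℕ) → ZMod 2)
    (a : ℕ → (Fin (m + 1) → ℕ) → ZMod 2) (z : Fin (m + 1) → ℕ) (r : ℕ) (hr : r < m) :
    ∑ σ : Equiv.Perm (Fin (m + 1)),
      cupCochain c a m (skipTerm (freudenthalVertex z σ) (r + 1)) = 0 := by
  let p : Fin (m + 1) := ⟨r, by omega⟩
  let q : Fin (m + 1) := ⟨r + 1, by omega⟩
  have hpq : p ≠ q := by simp [p, q, Fin.ext_iff]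
  have hv : ∀ (σ : Equiv.Perm (Fin (m + 1))) (i : ℕ), i ≠ r + 1 →
      freudenthalVertex z (σ.trans (Equiv.swap p q)) i = freudenthalVertex z σ i := by
    intro σ i hi
    ext j
    simp only [freudenthalVertex, Equiv.trans_apply]
    congr 1
    have : ((Equiv.swap p q (σ j) : Fin (m + 1)) : ℕ) < i ↔ (σ j : ℕ) < i := by
      rcases eq_or_ne (σ j) p with h | h
      · rw [h, Equiv.swap_apply_left]; simp only [p, q]; omega
      · rcases eq_or_ne (σ j) q with h' | h'
        · rw [h', Equiv.swap_apply_right]; simp only [p, q]; omega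
        · rw [Equiv.swap_apply_of_ne_of_ne h h']
    simp only [this]
  refine sum_ninvolution (fun σ => σ.trans (Equiv.swap p q)) ?_ ?_ (fun _ => mem_univ _) ?_
  · intro σ
    rw [cupCochain_congr c a (v := skipTerm (freudenthalVertex z σ) (r + 1))
      (u := skipTerm (freudenthalVertex z (σ.trans (Equiv.swap p q))) (r + 1))]
    · exact CharTwo.add_self_eq_zero _
    · intro i _
      simp only [skipTerm]
      split_ifs <;> exact hv _ _ (by omega)
  · intro σ _ h
    have := congrArg (fun τ : Equiv.Perm (Fin (m + 1)) => τ (σ.symm p)) h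
    simp only [Equiv.trans_apply, Equiv.apply_symm_apply, Equiv.swap_apply_left] at this
    exact hpq this.symm
  · intro σ
    ext j
    simp

theorem freudenthalVertex_rotate {m : ℕ} (z : Fin (m + 1) → ℕ) (σ : Equiv.Perm (Fin (m + 1)))
    (i : ℕ) (hi : i ≤ m) :
    freudenthalVertex z (σ.trans (finRotate (m + 1))) (i + 1) =
      freudenthalVertex (z + Pi.single (σ.symm (Fin.last m)) 1) σ i := by
  ext j
  simp only [freudenthalVertex, Pi.add_apply]
  rcases eq_or_ne (σ j) (Fin.last m) with h | h
  · have hj : σ.symm (Fin.last m) = j := by rw [← h, Equiv.symm_apply_apply]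
    have h0 : ((σ.trans (finRotate (m + 1)) j : Fin (m + 1)) : ℕ) = 0 := by
      rw [Equiv.trans_apply, h, finRotate_last, Fin.val_zero]
    have h1 : (σ j : ℕ) = m := by rw [h, Fin.val_last]
    simp only [h0, h1, hj, Pi.single_eq_same]
    rw [if_pos (Nat.succ_pos i), if_neg (Nat.not_lt.2 hi)]
  · have hj : j ≠ σ.symm (Fin.last m) := by
      rintro rfl
      simp at h
    have h0 : ((σ.trans (finRotate (m + 1)) j : Fin (m + 1)) : ℕ) = σ j + 1 := by
      rw [Equiv.trans_apply, coe_finRotate_of_ne_last h]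
    simp only [h0, Pi.single_eq_of_ne hj, Nat.add_lt_add_iff_right, add_zero]

/-- The face opposite the first vertex of a simplex is opposite the last vertex of a simplex in the
next cell (`freudenthalVertex_rotate`). Faces on the boundary of the grid contribute nothing, since
there `c` vanishes or some `a i` is constant. -/
theorem sum_cupCochain_first_eq_last {m k : ℕ} (c : (Fin (m + 1) → ℕ) → ZMod 2)
    (a : ℕ → (Fin (m + 1) → ℕ) → ZMod 2) (hc0 : ∀ x, x 0 = 0 → c x = 0)
    (hck : ∀ x, x 0 = k → c x = 0) (ha0 : ∀ (i : Fin m) x, x i.succ = 0 → a i x = 0)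
    (hak : ∀ (i : Fin m) x, x i.succ = k → a i x = 1) :
    ∑ z ∈ Fintype.piFinset (fun _ : Fin (m + 1) => range k), ∑ σ : Equiv.Perm (Fin (m + 1)),
      cupCochain c a m (skipTerm (freudenthalVertex z σ) 0) =
    ∑ z ∈ Fintype.piFinset (fun _ : Fin (m + 1) => range k), ∑ σ : Equiv.Perm (Fin (m + 1)),
      cupCochain c a m (skipTerm (freudenthalVertex z σ) (m + 1)) := by
  have hfirst : ∀ z : Fin (m + 1) → ℕ, ∑ σ : Equiv.Perm (Fin (m + 1)),
      cupCochain c a m (skipTerm (freudenthalVertex z σ) 0) =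
      ∑ σ : Equiv.Perm (Fin (m + 1)), cupCochain c a m
        (freudenthalVertex (z + Pi.single (σ.symm (Fin.last m)) 1) σ) := by
    intro z
    symm
    refine Fintype.sum_equiv (Equiv.mulLeft (finRotate (m + 1))) _ _ fun σ => ?_
    refine cupCochain_congr _ _ fun i hi => ?_
    simp only [skipTerm, Nat.not_lt_zero, if_false]
    exact (freudenthalVertex_rotate z σ i hi).symm
  have hlast : ∀ (z : Fin (m + 1) → ℕ) (σ : Equiv.Perm (Fin (m + 1))),
      cupCochain c a m (skipTerm (freudenthalVertex z σ) (m + 1)) =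
      cupCochain c a m (freudenthalVertex z σ) := by
    intro z σ
    refine cupCochain_congr _ _ fun i hi => ?_
    simp only [skipTerm]
    rw [if_pos (by omega)]
  simp only [hfirst, hlast]
  rw [sum_comm, sum_comm (t := univ)]
  refine sum_congr rfl fun σ _ => ?_
  set s := σ.symm (Fin.last m) with hs
  have hvs : ∀ z : Fin (m + 1) → ℕ, ∀ i ≤ m, freudenthalVertex z σ i s = z s := by
    intro z i hi
    simp only [freudenthalVertex, hs, Equiv.apply_symm_apply, Fin.val_last]
    rw [if_neg (by omega), add_zero]
  refine sum_piFinset_range_shift s (fun z => cupCochain c a m (freudenthalVertex z σ)) ?_ ?_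
  all_goals
    intro z hz
    unfold cupCochain
    rcases Fin.eq_zero_or_eq_succ s with h | ⟨i, h⟩
    · rw [h] at hz hvs
      first
      | rw [hc0 _ ((hvs z 0 (Nat.zero_le _)).trans hz), zero_mul]
      | rw [hck _ ((hvs z 0 (Nat.zero_le _)).trans hz), zero_mul]
    · rw [h] at hz hvs
      have hi := i.isLt
      refine mul_eq_zero_of_right _ (prod_eq_zero (mem_range.2 hi) ?_)
      first
      | rw [ha0 i _ ((hvs z i (by omega)).trans hz), ha0 i _ ((hvs z (i + 1) (by omega)).trans hz),
          add_zero]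
      | rw [hak i _ ((hvs z i (by omega)).trans hz), hak i _ ((hvs z (i + 1) (by omega)).trans hz),
          CharTwo.add_self_eq_zero]

/-- Stokes: the summand is a coboundary, and all faces cancel in pairs or vanish. -/
theorem freudenthalSum_eq_zero {m k : ℕ} (a : ℕ → (Fin (m + 1) → ℕ) → ZMod 2)
    (hc0 : ∀ x, x 0 = 0 → a 0 x = 0) (hck : ∀ x, x 0 = k → a 0 x = 0)
    (ha0 : ∀ (i : Fin m) x, x i.succ = 0 → a (i + 1) x = 0)
    (hak : ∀ (i : Fin m) x, x i.succ = k → a (i + 1) x = 1) :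
    freudenthalSum k a = 0 := by
  have key : ∀ (z : Fin (m + 1) → ℕ) (σ : Equiv.Perm (Fin (m + 1))),
      ∏ i ∈ range (m + 1), (a i (freudenthalVertex z σ (i + 1)) + a i (freudenthalVertex z σ i)) =
      ∑ r ∈ range (m + 2),
        cupCochain (a 0) (fun i => a (i + 1)) m (skipTerm (freudenthalVertex z σ) r) := by
    intro z σ
    rw [sum_cupCochain_skipTerm, prod_range_succ', mul_comm]
  unfold freudenthalSum
  simp only [key]
  have hsplit : ∀ z : Fin (m + 1) → ℕ, ∑ σ : Equiv.Perm (Fin (m + 1)), ∑ r ∈ range (m + 2),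
        cupCochain (a 0) (fun i => a (i + 1)) m (skipTerm (freudenthalVertex z σ) r) =
      ∑ σ : Equiv.Perm (Fin (m + 1)),
        cupCochain (a 0) (fun i => a (i + 1)) m (skipTerm (freudenthalVertex z σ) 0) +
      ∑ σ : Equiv.Perm (Fin (m + 1)),
        cupCochain (a 0) (fun i => a (i + 1)) m (skipTerm (freudenthalVertex z σ) (m + 1)) := by
    intro z
    rw [sum_comm, sum_range_succ, sum_range_succ', sum_eq_zero, zero_add]
    intro r hr
    exact sum_cupCochain_inner_eq_zero _ _ z r (mem_range.1 hr)
  simp only [hsplit]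
  rw [sum_add_distrib, sum_cupCochain_first_eq_last (a 0) (fun i => a (i + 1)) hc0 hck ha0 hak]
  exact CharTwo.add_self_eq_zero _

theorem freudenthalVertex_cons {m : ℕ} (t : ℕ) (z : Fin m → ℕ) (σ : Equiv.Perm (Fin m)) (i : ℕ) :
    freudenthalVertex (Fin.cons t z : Fin (m + 1) → ℕ) (Equiv.Perm.decomposeFin.symm (0, σ))
      (i + 1) = Fin.cons (t + 1) (freudenthalVertex z σ i) := by
  ext j
  refine Fin.cases ?_ (fun j => ?_) j
  · simp [freudenthalVertex]
  · simp [freudenthalVertex]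

/-- The first factor survives only if the first edge steps from layer `k - 1` to layer `k`, that is
`z 0 = k - 1` and `σ 0 = 0`. The remaining vertices then form a simplex of the facet `x 0 = k`. -/
theorem freudenthalSum_facet {m k : ℕ} (hk : 0 < k) (a : ℕ → (Fin (m + 1) → ℕ) → ZMod 2)
    (hb : ∀ x, a 0 x = if x 0 = k then 1 else 0) :
    freudenthalSum k a =
      freudenthalSum k (fun i (x : Fin m → ℕ) => a (i + 1) (Fin.cons k x)) := by
  obtain ⟨t, rfl⟩ : ∃ t, k = t + 1 := ⟨k - 1, by omega⟩
  unfold freudenthalSum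
  rw [← sum_product', ← sum_product']
  symm
  refine sum_of_injOn (fun p => ((Fin.cons t p.1 : Fin (m + 1) → ℕ),
    Equiv.Perm.decomposeFin.symm (0, p.2))) ?_ ?_ ?_ ?_
  · rintro ⟨z, σ⟩ _ ⟨z', σ'⟩ _ h
    simp only [Prod.mk.injEq, EmbeddingLike.apply_eq_iff_eq, true_and] at h
    exact Prod.ext (Fin.cons_right_injective (α := fun _ => ℕ) t h.1) h.2
  · rintro ⟨z, σ⟩ h
    simp only [coe_product, Set.mem_prod, mem_coe, Fintype.mem_piFinset, mem_range] at h ⊢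
    refine ⟨fun j => ?_, mem_univ _⟩
    refine Fin.cases ?_ (fun j => ?_) j
    · simp
    · simpa using h.1 j
  · rintro ⟨z, σ⟩ h hnot
    simp only [mem_product, Fintype.mem_piFinset, mem_range] at h
    by_contra hne
    apply hnot
    have h0 := prod_ne_zero_iff.1 hne 0 (by simp)
    have hz := h.1 0
    rw [hb, hb] at h0
    have hσ : (σ 0 : ℕ) = 0 ∧ z 0 = t := by
      by_contra hcon
      apply h0
      rw [if_neg, if_neg, add_zero] <;> dsimp only [freudenthalVertex] <;> split_ifs <;>
        omega
    refine ⟨(Fin.tail z, (Equiv.Perm.decomposeFin σ).2), ?_, ?_⟩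
    · simp only [coe_product, Set.mem_prod, mem_coe, Fintype.mem_piFinset, mem_range]
      exact ⟨fun j => h.1 j.succ, mem_univ _⟩
    · refine Prod.ext ?_ ?_
      · simp only
        rw [← hσ.2, Fin.cons_self_tail]
      · simp only
        rw [Equiv.symm_apply_eq]
        refine Prod.ext ?_ rfl
        have := Equiv.Perm.decomposeFin_symm_apply_zero (Equiv.Perm.decomposeFin σ).1
          (Equiv.Perm.decomposeFin σ).2
        rw [Prod.mk.eta, Equiv.symm_apply_apply] at this
        rw [← this]
        exact (Fin.ext hσ.1).symm
  · rintro ⟨z, σ⟩ h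
    simp only [mem_product, Fintype.mem_piFinset, mem_range] at h
    simp only
    rw [prod_range_succ']
    simp only [freudenthalVertex_cons]
    have h1 : freudenthalVertex (Fin.cons t z : Fin (m + 1) → ℕ)
      (Equiv.Perm.decomposeFin.symm (0, σ)) 0 0 = t := by simp [freudenthalVertex]
    rw [hb, hb, h1]
    simp

theorem freudenthalSum_add_update {m k : ℕ} (a : ℕ → (Fin (m + 1) → ℕ) → ZMod 2)
    (b c : (Fin (m + 1) → ℕ) → ZMod 2) (h : ∀ x, a 0 x = b x + c x) :
    freudenthalSum k a =
      freudenthalSum k (Function.update a 0 b) + freudenthalSum k (Function.update a 0 c) := by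
  unfold freudenthalSum
  simp only [← sum_add_distrib]
  refine sum_congr rfl fun z _ => sum_congr rfl fun σ _ => ?_
  simp only [prod_range_succ', Function.update_self, ne_eq, Nat.add_eq_zero_iff, one_ne_zero,
    and_false, not_false_eq_true, Function.update_of_ne, h]
  ring

theorem freudenthalSum_eq_one {n k : ℕ} (hk : 0 < k) (a : ℕ → (Fin n → ℕ) → ZMod 2)
    (ha0 : ∀ (i : Fin n) x, x i = 0 → a i x = 0)
    (hak : ∀ (i : Fin n) x, x i = k → a i x = 1) : freudenthalSum k a = 1 := by
  induction n with
  | zero => simp [freudenthalSum]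
  | succ m ih =>
    -- Split `a 0` into the indicator of `x 0 = k`, which reduces the dimension, and a remainder
    -- vanishing on both facets, which contributes zero.
    rw [freudenthalSum_add_update a (fun x => if x 0 = k then 1 else 0)
      (fun x => a 0 x + if x 0 = k then 1 else 0), freudenthalSum_facet hk,
      freudenthalSum_eq_zero, add_zero]
    · simp only [ne_eq, Nat.add_eq_zero_iff, one_ne_zero,
        and_false, not_false_eq_true, Function.update_of_ne]
      exact ih _ (fun i x hx => ha0 i.succ _ hx) (fun i x hx => hak i.succ _ hx)
    · intro x hx
      have := ha0 0 x hx
      simp only [Fin.val_zero] at this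
      simp [hx, this, hk.ne]
    · intro x hx
      have := hak 0 x hx
      simp only [Fin.val_zero] at this
      simp [hx, this, CharTwo.add_self_eq_zero]
    · intro i x hx
      simpa using ha0 i.succ x hx
    · intro i x hx
      simpa using hak i.succ x hx
    · simp
    · intro x
      have := CharTwo.add_self_eq_zero (if x 0 = k then (1 : ZMod 2) else 0)
      linear_combination -this

/-! ### From sign labels to the Poincaré–Miranda theorem -/

/-- A labelling of the grid `{0, …, k}^n` by `n` signs, the `i`-th of which is different on the two
facets in the direction `i`, has a Freudenthal simplex along which every sign changes. -/
theorem exists_freudenthal_sign_change {n k : ℕ} (hk : 0 < k) (S : Fin n → Set (Fin n → ℕ))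
    (h0 : ∀ i x, x i = 0 → x ∉ S i) (h1 : ∀ i x, x i = k → x ∈ S i) :
    ∃ z : Fin n → ℕ, (∀ j, z j < k) ∧ ∀ i, ∃ p q : Fin n → ℕ, p ∈ S i ∧ q ∉ S i ∧
      ∀ j, (z j ≤ p j ∧ p j ≤ z j + 1) ∧ (z j ≤ q j ∧ q j ≤ z j + 1) := by
  classical
  let a : ℕ → (Fin n → ℕ) → ZMod 2 := fun i x => if h : i < n then
    if x ∈ S ⟨i, h⟩ then 1 else 0 else 0
  have ha : ∀ (i : Fin n) x, a i x = if x ∈ S i then 1 else 0 := by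
    intro i x
    simp [a]
  have hsum : freudenthalSum k a ≠ 0 := by
    rw [freudenthalSum_eq_one hk a]
    · exact one_ne_zero
    · intro i x hx
      rw [ha, if_neg (h0 i x hx)]
    · intro i x hx
      rw [ha, if_pos (h1 i x hx)]
  obtain ⟨z, hz, hne⟩ := exists_ne_zero_of_sum_ne_zero hsum
  obtain ⟨σ, -, hne⟩ := exists_ne_zero_of_sum_ne_zero hne
  refine ⟨z, fun j => mem_range.1 (Fintype.mem_piFinset.1 hz j), fun i => ?_⟩
  have hi := prod_ne_zero_iff.1 hne i (mem_range.2 i.isLt)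
  rw [ha, ha] at hi
  have hv : ∀ r j, z j ≤ freudenthalVertex z σ r j ∧ freudenthalVertex z σ r j ≤ z j + 1 := by
    intro r j
    unfold freudenthalVertex
    split_ifs <;> omega
  by_cases hp : freudenthalVertex z σ (i + 1) ∈ S i
  · by_cases hq : freudenthalVertex z σ i ∈ S i
    · rw [if_pos hp, if_pos hq] at hi
      exact absurd (CharTwo.add_self_eq_zero _) hi
    · exact ⟨_, _, hp, hq, fun j => ⟨hv _ j, hv _ j⟩⟩
  · by_cases hq : freudenthalVertex z σ i ∈ S i
    · exact ⟨_, _, hq, hp, fun j => ⟨hv _ j, hv _ j⟩⟩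
    · rw [if_neg hp, if_neg hq] at hi
      simp at hi

open Filter Topology in
/-- The Poincaré–Miranda theorem. -/
theorem exists_common_zero_of_sign_change {n : ℕ} (f : Fin n → (Fin n → ℝ) → ℝ)
    (hf : ∀ i, Continuous (f i)) (h0 : ∀ i x, x i = 0 → f i x ≤ 0)
    (h1 : ∀ i x, x i = 1 → 0 < f i x) : ∃ x ∈ unitCube n, ∀ i, f i x = 0 := by
  have approx : ∀ k : ℕ, ∃ x ∈ unitCube n, ∀ i, ∃ p q : Fin n → ℝ, 0 < f i p ∧ f i q ≤ 0 ∧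
      dist p x ≤ 1 / ((k : ℝ) + 1) ∧ dist q x ≤ 1 / ((k : ℝ) + 1) := by
    intro k
    have hk : (0 : ℝ) < (k : ℝ) + 1 := by positivity
    obtain ⟨z, hz, hpq⟩ := exists_freudenthal_sign_change (Nat.succ_pos k)
      (fun i => {x : Fin n → ℕ | 0 < f i (fun j => (x j : ℝ) / ((k : ℝ) + 1))})
      (fun i x hx => not_lt.2 (h0 i _ (by simp [hx])))
      (fun i x hx => h1 i _ (by simp [hx, hk.ne']))
    have hdist : ∀ p : Fin n → ℕ, (∀ j, z j ≤ p j ∧ p j ≤ z j + 1) →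
        dist (fun j => (p j : ℝ) / ((k : ℝ) + 1)) (fun j => (z j : ℝ) / ((k : ℝ) + 1)) ≤
          1 / ((k : ℝ) + 1) := by
      intro p hp
      refine (dist_pi_le_iff (by positivity)).2 fun j => ?_
      have hl : (z j : ℝ) ≤ p j := by exact_mod_cast (hp j).1
      have hr : (p j : ℝ) ≤ z j + 1 := by exact_mod_cast (hp j).2
      rw [Real.dist_eq, ← sub_div, abs_div, abs_of_pos hk, abs_of_nonneg (by linarith)]
      gcongr
      linarith
    refine ⟨fun j => (z j : ℝ) / ((k : ℝ) + 1), fun j => ⟨by positivity, ?_⟩, fun i => ?_⟩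
    · rw [div_le_one hk]
      exact_mod_cast (hz j).le
    · obtain ⟨p, q, hp, hq, h⟩ := hpq i
      exact ⟨_, _, hp, not_lt.1 hq, hdist p fun j => (h j).1, hdist q fun j => (h j).2⟩
  choose x hx p q hp hq hpx hqx using approx
  have hcube : unitCube n = Set.Icc 0 1 := by
    ext y
    simp [unitCube, Pi.le_def, forall_and]
  obtain ⟨y, hy, φ, hφ, hlim⟩ := (hcube ▸ isCompact_Icc : IsCompact (unitCube n)).tendsto_subseq hx
  have hsmall : Tendsto (fun k => 1 / ((φ k : ℝ) + 1)) atTop (𝓝 0) :=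
    tendsto_one_div_add_atTop_nhds_zero_nat.comp hφ.tendsto_atTop
  have hconv : ∀ u : ℕ → Fin n → ℝ, (∀ k, dist (u k) (x k) ≤ 1 / ((k : ℝ) + 1)) →
      Tendsto (u ∘ φ) atTop (𝓝 y) := by
    intro u hu
    refine hlim.congr_dist (squeeze_zero (fun _ => dist_nonneg) (fun k => ?_) hsmall)
    rw [dist_comm]
    exact hu (φ k)
  -- Both `p` and `q` converge to `y` along `φ`, so `f i y` is a limit of nonpositive and of
  -- positive values.
  refine ⟨y, hy, fun i => le_antisymm ?_ ?_⟩
  · exact le_of_tendsto' (((hf i).tendsto y).comp (hconv (fun k => q k i) fun k => hqx k i))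
      fun k => hq (φ k) i
  · exact ge_of_tendsto' (((hf i).tendsto y).comp (hconv (fun k => p k i) fun k => hpx k i))
      fun k => (hp (φ k) i).le

/-! ### Separation by components and the covering theorem -/

/-- In a compact set `X`, two closed sets that no component of `X` joins are separated by a
partition of `X` into two closed sets. -/
theorem IsCompact.exists_closed_partition {E : Type*} [TopologicalSpace E] [T2Space E]
    {X F G : Set E} (hX : IsCompact X) (hF : IsClosed F) (hG : IsClosed G)
    (h : ∀ x ∈ X, x ∈ F → Disjoint (connectedComponentIn X x) G) :
    ∃ A B : Set E, IsClosed A ∧ IsClosed B ∧ A ∪ B = X ∧ Disjoint A B ∧ Disjoint A G ∧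
      Disjoint B F := by
  have : CompactSpace X := isCompact_iff_compactSpace.1 hX
  let π : X → ConnectedComponents X := ConnectedComponents.mk
  have hπ : Continuous π := ConnectedComponents.continuous_coe
  have hFc : IsClosed (π '' ((↑) ⁻¹' F)) :=
    ((hF.preimage continuous_subtype_val).isCompact.image hπ).isClosed
  have hGc : IsClosed (π '' ((↑) ⁻¹' G)) :=
    ((hG.preimage continuous_subtype_val).isCompact.image hπ).isClosed
  have hsub : π '' ((↑) ⁻¹' F) ⊆ (π '' ((↑) ⁻¹' G))ᶜ := by
    rintro _ ⟨x, hx, rfl⟩ ⟨y, hy, hxy⟩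
    refine Set.disjoint_left.1 (h x x.2 hx) ?_ hy
    rw [connectedComponentIn_eq_image x.2]
    exact ⟨y, ConnectedComponents.coe_eq_coe'.1 hxy, rfl⟩
  -- The space of components is compact, Hausdorff and totally disconnected, so a clopen set
  -- separates the disjoint closed images of `F` and `G`.
  obtain ⟨C, hC, hFC, hCG⟩ := exists_clopen_of_closed_subset_open hFc hGc.isOpen_compl hsub
  have hD : IsClopen (π ⁻¹' C) := hC.preimage hπ
  refine ⟨(↑) '' (π ⁻¹' C), (↑) '' (π ⁻¹' C)ᶜ,
    (hD.isClosed.isCompact.image continuous_subtype_val).isClosed,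
    (hD.compl.isClosed.isCompact.image continuous_subtype_val).isClosed, ?_, ?_, ?_, ?_⟩
  · rw [← Set.image_union, Set.union_compl_self, Set.image_univ, Subtype.range_coe]
  · exact (Set.disjoint_image_iff Subtype.val_injective).2 disjoint_compl_right
  · rw [Set.disjoint_left]
    rintro _ ⟨x, hx, rfl⟩ hxG
    exact hCG hx ⟨x, hxG, rfl⟩
  · rw [Set.disjoint_left]
    rintro _ ⟨x, hx, rfl⟩ hxF
    exact hx (hFC ⟨x, hxF, rfl⟩)

theorem Metric.exists_continuous_sign_of_disjoint {E : Type*} [PseudoMetricSpace E] {A B : Set E}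
    (hA : IsClosed A) (hB : IsClosed B) (hAne : A.Nonempty) (hBne : B.Nonempty)
    (h : Disjoint A B) :
    ∃ f : E → ℝ, Continuous f ∧ (∀ x ∈ A, 0 < f x) ∧ ∀ x ∈ B, f x < 0 := by
  refine ⟨fun x => Metric.infDist x B - Metric.infDist x A,
    (Metric.continuous_infDist_pt B).sub (Metric.continuous_infDist_pt A), ?_, ?_⟩
  · intro x hx
    have := (hB.notMem_iff_infDist_pos hBne).1 (Set.disjoint_left.1 h hx)
    simpa [Metric.infDist_zero_of_mem hx] using this
  · intro x hx
    have := (hA.notMem_iff_infDist_pos hAne).1 (Set.disjoint_right.1 h hx)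
    simpa [Metric.infDist_zero_of_mem hx] using this

theorem mainTheorem3 (n : ℕ) (X : Fin n → Set (Fin n → ℝ))
    (hclosed : ∀ i, IsClosed (X i))
    (hsub : ∀ i, X i ⊆ unitCube n)
    (hcover : unitCube n ⊆ ⋃ i, X i) :
    ∃ i : Fin n, ∃ C : Set (Fin n → ℝ), IsComponentOf C (X i) ∧
      (C ∩ facetPlus i).Nonempty ∧ (C ∩ facetMinus i).Nonempty := by
  by_contra hcon
  have hcube : unitCube n = Set.Icc 0 1 := by
    ext y
    simp [unitCube, Pi.le_def, forall_and]
  have sign : ∀ i, ∃ f : (Fin n → ℝ) → ℝ, Continuous f ∧ (∀ x, x i = 0 → f x < 0) ∧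
      (∀ x, x i = 1 → 0 < f x) ∧ ∀ x ∈ X i, f x ≠ 0 := by
    intro i
    have hX : IsCompact (X i) :=
      (isCompact_Icc (a := (0 : Fin n → ℝ)) (b := 1)).of_isClosed_subset (hclosed i)
        (hcube ▸ hsub i)
    have hP : IsClosed {x : Fin n → ℝ | x i = 1} :=
      isClosed_eq (continuous_apply i) continuous_const
    have hM : IsClosed {x : Fin n → ℝ | x i = 0} :=
      isClosed_eq (continuous_apply i) continuous_const
    obtain ⟨A, B, hA, hB, hAB, hdisj, hAM, hBP⟩ := hX.exists_closed_partition hP hM (by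
      intro x hx hx1
      rw [Set.disjoint_left]
      intro y hy hy0
      have hyX : y ∈ X i := connectedComponentIn_subset _ _ hy
      exact hcon ⟨i, _, ⟨x, hx, rfl⟩, ⟨x, mem_connectedComponentIn hx, hsub i hx, hx1⟩,
        ⟨y, hy, hsub i hyX, hy0⟩⟩)
    -- Adjoining the whole hyperplanes prescribes the signs there and makes both sets nonempty even
    -- if `A` or `B` is empty.
    obtain ⟨f, hf, hfpos, hfneg⟩ := Metric.exists_continuous_sign_of_disjoint (hA.union hP)
      (hB.union hM) ⟨fun _ => 1, Or.inr rfl⟩ ⟨fun _ => 0, Or.inr rfl⟩ (by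
        rw [Set.disjoint_union_left, Set.disjoint_union_right, Set.disjoint_union_right]
        refine ⟨⟨hdisj, hAM⟩, hBP.symm, ?_⟩
        rw [Set.disjoint_left]
        intro x hx1 hx0
        exact one_ne_zero (hx1.symm.trans hx0))
    refine ⟨f, hf, fun x hx => hfneg x (Or.inr hx), fun x hx => hfpos x (Or.inr hx), ?_⟩
    intro x hx
    rcases (hAB ▸ hx : x ∈ A ∪ B) with h | h
    · exact (hfpos x (Or.inl h)).ne'
    · exact (hfneg x (Or.inl h)).ne
  choose f hf h0 h1 hne using sign
  obtain ⟨x, hx, hzero⟩ := exists_common_zero_of_sign_change f hf (fun i x hx => (h0 i x hx).le) h1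
  obtain ⟨i, hi⟩ := Set.mem_iUnion.1 (hcover hx)
  exact hne i x hi (hzero i)
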